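/- Let $p,q:\mathbb R^D\to(0,\infty)$ be continuously differentiable, everywhere positive probability densities, with $q(x)\to 0$ as $\|x\|\to\infty$. Let $s_p=\nabla\log p$, $s_q=\nabla\log q$ be their scores, write $s_p^r(x)=s_p(x)^{T}r$, and assume that for every $r\in\mathbb S^{D-1}$ $$\int_{\mathbb R^D} q\,|(s_p-s_q)^{T}r|\,dx<\infty ,\qquad \int_{\mathbb R^D} q\,|(s_p-s_q)^{T}r|^2\,dx<\infty .$$ Let $O_r$ be an orthonormal basis of $\mathbb R^D$. For every $r\in O_r$ and $g\in\mathbb S^{D-1}$ let $\mathcal H_{rg}$ be a reproducing kernel Hilbert space of functions $\mathbb R\to\mathbb R$ with kernel $k_{rg}$, such that: (i) $k_{rg}$ is $C_0$-universal, i.e. $\mathcal H_{rg}$ is contained in $C_0(\mathbb R)$ and is dense in it for the uniform norm; (ii) the kernel $k(x,x')=k_{rg}(x^{T}g,x'^{T}g)$ on $\mathbb R^D$ is in the Stein class of $q$, i.e. it has continuous second order partial derivatives, and for each fixed value of one argument the function $f$ of the other argument is continuously differentiable with $\nabla(fq)$ integrable and $\int_{\mathbb R^D}\nabla(fq)\,dx=0$;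 (iii) $\sup_x k_{rg}(x^{T}g,x^{T}g)<\infty$; (iv) $\mathbb E_{x\sim q}[h_{p,r,g}(x,x)]<\infty$, where, with $s=x^{T}g$ and $t=y^{T}g$, $$h_{p,r,g}(x,y)=s_p^r(x)\,k_{rg}(s,t)\,s_p^r(y)+r^{T}g\,s_p^r(y)\,\partial_s k_{rg}(s,t)+r^{T}g\,s_p^r(x)\,\partial_t k_{rg}(s,t)+(r^{T}g)^2\,\partial_s\partial_t k_{rg}(s,t).$$ Define $$D^2_{rg}(q,p)=\Big(\sup_{f\in\mathcal H_{rg},\,\|f\|\le 1}\mathbb E_{x\sim q}\big[s_p^r(x)f(x^{T}g)+r^{T}g\,f'(x^{T}g)\big]\Big)^2,\qquad SK_{\max}(q,p)=\sum_{r\in O_r}\ \sup_{g\in\mathbb S^{D-1}}D^2_{rg}(q,p)\in[0,\infty].$$ Then $SK_{\max}(q,p)=0$ if and only if $p=q$ almost everywhere. -/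

import Mathlib

noncomputable section

open MeasureTheory Filter Topology

namespace SKSD

/-- The Euclidean space `ℝ^D`. -/
abbrev Eucl (D : ℕ) : Type := EuclideanSpace ℝ (Fin D)

/-- The unit sphere `𝕊^{D-1}` of `ℝ^D`. -/
abbrev Sph (D : ℕ) : Type := Metric.sphere (0 : Eucl D) 1

/-- A continuously differentiable probability density supported on all of `ℝ^D`
(everywhere positive, so that its score is defined everywhere). -/
structure IsC1Density {D : ℕ} (p : Eucl D → ℝ) : Prop where
  pos : ∀ x, 0 < p x
  contDiff : ContDiff ℝ 1 p
  integrable : Integrable p volume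
  integral_eq_one : ∫ x, p x = 1

/-- The score `s_p(x) = ∇ log p(x)`. -/
def score {D : ℕ} (p : Eucl D → ℝ) (x : Eucl D) : Eucl D :=
  gradient (fun z => Real.log (p z)) x

/-- The projected score `s_p^r(x) = s_p(x)ᵀ r`. -/
def projScore {D : ℕ} (p : Eucl D → ℝ) (r x : Eucl D) : ℝ :=
  inner ℝ (score p x) r

/-- The expectation `𝔼_q[φ(x)]` for a density `q`. -/
def expect {D : ℕ} (q : Eucl D → ℝ) (φ : Eucl D → ℝ) : ℝ :=
  ∫ x, q x * φ x

/-- The Stein class of `q`: `∫ ∇(f q) dx = 0`, the integral being absolutely convergent. -/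
structure InSteinClass {D : ℕ} (q f : Eucl D → ℝ) : Prop where
  contDiff : ContDiff ℝ 1 f
  integrable : Integrable (fun x => gradient (fun z => f z * q z) x) volume
  integral_eq_zero : ∫ x, gradient (fun z => f z * q z) x = 0

/-- A kernel on `ℝ^D` in the Stein class of `q`: it has continuous second order partial
derivatives, and all its sections, in either argument, lie in the Stein class of `q`. -/
structure KernelInSteinClass {D : ℕ} (q : Eucl D → ℝ) (k : Eucl D → Eucl D → ℝ) : Prop where
  contDiff : ContDiff ℝ 2 (fun z : Eucl D × Eucl D => k z.1 z.2)
  left : ∀ x, InSteinClass q (fun y => k x y)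
  right : ∀ x, InSteinClass q (fun y => k y x)

section RKHSDefs

variable (H : Type*) [NormedAddCommGroup H] [InnerProductSpace ℝ H] [RKHS ℝ H ℝ ℝ]

/-- `C₀`-universality of (the kernel of) a reproducing kernel Hilbert space of real functions on
`ℝ`: its elements are continuous functions vanishing at infinity, and they are uniformly dense in
`C₀(ℝ)`. -/
structure IsC0Universal : Prop where
  continuous : ∀ f : H, Continuous f
  zero_at_infty : ∀ f : H, Tendsto f (cocompact ℝ) (𝓝 0)
  dense : ∀ φ : ZeroAtInftyContinuousMap ℝ ℝ, ∀ ε > 0, ∃ f : H, ∀ t, |f t - φ t| ≤ ε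

/-- The reproducing kernel, as a real function `k(s, t)` on `ℝ × ℝ`. -/
def ker [CompleteSpace H] (s t : ℝ) : ℝ := RKHS.kernel H s t 1

end RKHSDefs

/-- The kernel `k(x, y) = κ(xᵀg, yᵀg)` on `ℝ^D` induced by a kernel `κ` on `ℝ`. -/
def slicedKernel {D : ℕ} (κ : ℝ → ℝ → ℝ) (g x y : Eucl D) : ℝ :=
  κ (inner ℝ x g) (inner ℝ y g)

/-- `h_{p,r,g}(x, y)` for the one-dimensional kernel `κ`. -/
def steinKernel {D : ℕ} (κ : ℝ → ℝ → ℝ) (p : Eucl D → ℝ) (r g x y : Eucl D) : ℝ :=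
  projScore p r x * κ (inner ℝ x g) (inner ℝ y g) * projScore p r y
    + inner ℝ r g * projScore p r y * deriv (fun s => κ s (inner ℝ y g)) (inner ℝ x g)
    + inner ℝ r g * projScore p r x * deriv (fun t => κ (inner ℝ x g) t) (inner ℝ y g)
    + (inner ℝ r g) ^ 2 *
      deriv (fun s => deriv (fun t => κ s t) (inner ℝ y g)) (inner ℝ x g)

/-- The sliced Stein operator
`s_p^r(x) f(xᵀg) + rᵀg f'(xᵀg)` applied to `f : ℝ → ℝ`. -/
def slicedStein {D : ℕ} (p : Eucl D → ℝ) (r g : Eucl D) (f : ℝ → ℝ) (x : Eucl D) : ℝ :=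
  projScore p r x * f (inner ℝ x g) + inner ℝ r g * deriv f (inner ℝ x g)

/-- `D²_{rg}(q, p)`: the square of the supremum, over the unit ball of the reproducing kernel
Hilbert space `H`, of `𝔼_q[s_p^r(x) f(xᵀg) + rᵀg f'(xᵀg)]`. The supremum is taken in the extended
reals; it is nonnegative, as `f = 0` is admissible. -/
def discSq {D : ℕ} (H : Type*) [NormedAddCommGroup H] [InnerProductSpace ℝ H]
    [RKHS ℝ H ℝ ℝ] (q p : Eucl D → ℝ) (r g : Eucl D) : ENNReal :=
  (⨆ f : {f : H // ‖f‖ ≤ 1},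
    ((expect q (slicedStein p r g (f : H)) : ℝ) : EReal)).toENNReal ^ 2

/-- `SK_max(q, p) = ∑_{r ∈ O_r} sup_{g ∈ 𝕊^{D-1}} D²_{rg}(q, p)`, a value in `[0, ∞]`. -/
def maxSKSD {D : ℕ} (O : OrthonormalBasis (Fin D) ℝ (Eucl D)) (H : Fin D → Sph D → Type*)
    [∀ i g, NormedAddCommGroup (H i g)] [∀ i g, InnerProductSpace ℝ (H i g)]
    [∀ i g, RKHS ℝ (H i g) ℝ ℝ] (q p : Eucl D → ℝ) : ENNReal :=
  ∑ i, ⨆ g : Sph D, discSq (H i g) q p (O i) (g : Eucl D)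

end SKSD

end

/-! Put `w = q (s_p - s_q)ᵀ r`. Everything rests on the identity `𝔼_q[s_p^r f(xᵀg) + rᵀg f'(xᵀg)] =
∫ w f(xᵀg)` for all `f` in the RKHS (`expect_slicedStein`). The two sides differ by the Stein
expectation of `q` itself, which the Stein class hypothesis kills only on kernel sections. It is
nevertheless a bounded functional of `f`, so its Riesz representer vanishes pointwise. This needs a
differentiable feature map, obtained from the `C²` kernel by `differentiable_of_contDiff_inner`.

A zero discrepancy thus makes `w` orthogonal to all ridge functions `f(xᵀg)`, first for `f` in the
RKHS, then by universality for `f` in `C₀(ℝ)`. By a Cramér–Wold argument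
(`ae_eq_zero_of_integral_ridge_eq_zero`) `w = 0`. As `q > 0`, the scores agree, hence so do the
normalized densities. Conversely, `p = q` gives `w = 0`. -/

noncomputable section
open MeasureTheory Filter Topology
namespace SKSD

/-! ### Differentiability of Hilbert space curves with `C²` Gram kernel -/

section Differentiability

/-- A mixed second difference of a function whose mixed derivative is `ε`-close to `c`. -/
theorem abs_mixed_difference_sub_le {k k₂ k₁₂ : ℝ → ℝ → ℝ} {S : Set ℝ} (hS : Convex ℝ S)
    (h₂ : ∀ s t, HasDerivAt (k s) (k₂ s t) t)
    (h₁₂ : ∀ s t, HasDerivAt (fun s => k₂ s t) (k₁₂ s t) s)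
    {c ε : ℝ} (hε : ∀ s ∈ S, ∀ t ∈ S, |k₁₂ s t - c| ≤ ε)
    {a b d e : ℝ} (ha : a ∈ S) (hb : b ∈ S) (hd : d ∈ S) (he : e ∈ S) :
    |k a d - k b d - (k a e - k b e) - c * (a - b) * (d - e)| ≤ ε * |a - b| * |d - e| := by
  -- The mean value inequality is used twice, here in `s` and then in `t`.
  have inner_bound : ∀ t ∈ S, ‖k₂ a t - k₂ b t - c * (a - b)‖ ≤ ε * |a - b| := by
    intro t ht
    have := hS.norm_image_sub_le_of_norm_hasDerivWithin_le
      (f := fun s => k₂ s t - c * s) (f' := fun s => k₁₂ s t - c) (C := ε)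
      (fun s _ => by
        simpa using ((h₁₂ s t).fun_sub ((hasDerivAt_id' s).const_mul c)).hasDerivWithinAt)
      (fun s hs => hε s hs t ht) hb ha
    simp only [Real.norm_eq_abs] at this ⊢
    convert this using 2
    ring
  have := hS.norm_image_sub_le_of_norm_hasDerivWithin_le
    (f := fun t => k a t - k b t - c * (a - b) * t)
    (f' := fun t => k₂ a t - k₂ b t - c * (a - b)) (C := ε * |a - b|)
    (fun t _ => by
      simpa using (((h₂ a t).fun_sub (h₂ b t)).fun_sub
        ((hasDerivAt_id' t).const_mul (c * (a - b)))).hasDerivWithinAt)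
    inner_bound he hd
  simp only [Real.norm_eq_abs] at this
  convert this using 2
  ring

variable {E : Type*} [NormedAddCommGroup E] [InnerProductSpace ℝ E]

/-- A curve in a Hilbert space is differentiable if its Gram kernel is `C²`. -/
theorem differentiable_of_contDiff_inner [CompleteSpace E] {Φ : ℝ → E}
    (hΦ : ContDiff ℝ 2 (fun z : ℝ × ℝ => inner ℝ (Φ z.1) (Φ z.2))) : Differentiable ℝ Φ := by
  set K : ℝ × ℝ → ℝ := fun z => inner ℝ (Φ z.1) (Φ z.2) with hK
  set K₂ : ℝ × ℝ → ℝ := fun z => fderiv ℝ K z (0, 1) with hK₂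
  have hK₂C : ContDiff ℝ 1 K₂ :=
    (hΦ.fderiv_right (m := 1) (by norm_num)).clm_apply contDiff_const
  set K₁₂ : ℝ × ℝ → ℝ := fun z => fderiv ℝ K₂ z (1, 0) with hK₁₂
  have hK₁₂C : Continuous K₁₂ := (hK₂C.continuous_fderiv (by norm_num)).clm_apply continuous_const
  have h₂ : ∀ s t, HasDerivAt (fun t => K (s, t)) (K₂ (s, t)) t := fun s t =>
    ((hΦ.differentiable (by norm_num)) (s, t)).hasFDerivAt.comp_hasDerivAt t
      ((hasDerivAt_const t s).prodMk (hasDerivAt_id t))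
  have h₁₂ : ∀ s t, HasDerivAt (fun s => K₂ (s, t)) (K₁₂ (s, t)) s := fun s t =>
    ((hK₂C.differentiable (by norm_num)) (s, t)).hasFDerivAt.comp_hasDerivAt (f := (·, t)) s
      ((hasDerivAt_id s).prodMk (hasDerivAt_const s t))
  intro s
  suffices h : ∃ y, Tendsto (slope Φ s) (𝓝[≠] s) (𝓝 y) by
    obtain ⟨y, hy⟩ := h
    exact (hasDerivAt_iff_tendsto_slope.2 hy).differentiableAt
  -- By completeness no candidate derivative is needed: it is enough that the slopes are Cauchy.
  rw [← cauchy_map_iff_exists_tendsto, Metric.cauchy_iff]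
  refine ⟨inferInstance, fun η hη => ?_⟩
  set c := K₁₂ (s, s)
  have hη2 : 0 < η ^ 2 / 8 := by positivity
  obtain ⟨δ, hδ, hball⟩ := Metric.continuousAt_iff.1 (hK₁₂C.continuousAt (x := (s, s)))
    (η ^ 2 / 8) hη2
  refine ⟨slope Φ s '' (Metric.ball s δ ∩ {s}ᶜ), image_mem_map
    (inter_mem (mem_nhdsWithin_of_mem_nhds (Metric.ball_mem_nhds s hδ)) self_mem_nhdsWithin), ?_⟩
  have gram : ∀ a ∈ Metric.ball s δ ∩ {s}ᶜ, ∀ b ∈ Metric.ball s δ ∩ {s}ᶜ,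
      |inner ℝ (slope Φ s a) (slope Φ s b) - c| ≤ η ^ 2 / 8 := by
    rintro a ⟨ha, has⟩ b ⟨hb, hbs⟩
    have has' : a - s ≠ 0 := sub_ne_zero.2 has
    have hbs' : b - s ≠ 0 := sub_ne_zero.2 hbs
    have := abs_mixed_difference_sub_le (k := fun s t => K (s, t)) (convex_ball s δ) h₂ h₁₂
      (c := c) (ε := η ^ 2 / 8)
      (fun u hu v hv => (hball (x := (u, v)) (by
        rw [Prod.dist_eq]; exact max_lt hu hv)).le)
      ha (Metric.mem_ball_self hδ) hb (Metric.mem_ball_self hδ)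
    have e : inner ℝ (slope Φ s a) (slope Φ s b) - c
        = (K (a, b) - K (s, b) - (K (a, s) - K (s, s)) - c * (a - s) * (b - s))
          / ((a - s) * (b - s)) := by
      simp only [hK, slope_def_module, inner_smul_left, inner_smul_right, inner_sub_left,
        inner_sub_right, RCLike.conj_to_real]
      field_simp
    rw [e, abs_div, abs_mul, div_le_iff₀ (by positivity)]
    linarith
  rintro _ ⟨a, ha, rfl⟩ _ ⟨b, hb, rfl⟩
  rw [dist_eq_norm]
  refine lt_of_pow_lt_pow_left₀ 2 hη.le ?_
  rw [norm_sub_sq_real, ← real_inner_self_eq_norm_sq, ← real_inner_self_eq_norm_sq]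
  have h1 := abs_le.1 (gram a ha a ha)
  have h2 := abs_le.1 (gram a ha b hb)
  have h3 := abs_le.1 (gram b hb b hb)
  -- The three Gram errors enter with weights 1, 2, 1, so the squared distance is at most `η ^ 2 /
  -- 2`.
  nlinarith [h1.2, h2.1, h3.2]

end Differentiability

/-! ### Feature map and representers of the Stein operator -/

section Feature

variable (H : Type*) [NormedAddCommGroup H] [InnerProductSpace ℝ H] [RKHS ℝ H ℝ ℝ]
  [CompleteSpace H]

/-- The canonical feature map `s ↦ k(s, ·)`. -/
def feature (s : ℝ) : H := RKHS.kerFun H s (1 : ℝ)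

variable {H} in
theorem inner_feature (s : ℝ) (f : H) : inner ℝ (feature H s) f = f s := by
  simp [feature]

theorem ker_eq_inner (s t : ℝ) : ker H s t = inner ℝ (feature H s) (feature H t) := by
  rw [inner_feature]; simp [ker, feature, RKHS.kerFun_apply]

theorem feature_apply (s t : ℝ) : feature H t s = ker H s t := by
  rw [ker_eq_inner, inner_feature]

theorem ker_comm (s t : ℝ) : ker H s t = ker H t s := by
  rw [ker_eq_inner, ker_eq_inner, real_inner_comm]

theorem norm_feature_sq (s : ℝ) : ‖feature H s‖ ^ 2 = ker H s s := by
  rw [ker_eq_inner, real_inner_self_eq_norm_sq]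

variable {H}

theorem hasDerivAt_of_differentiable_feature (hd : Differentiable ℝ (feature H)) (f : H) (s : ℝ) :
    HasDerivAt f (inner ℝ (deriv (feature H) s) f) s := by
  have := (hd s).hasDerivAt.inner ℝ (hasDerivAt_const s f)
  simpa [inner_feature] using this

variable {D : ℕ}

variable (H) in
/-- The element `s_p^r(x) k(xᵀg, ·) + rᵀg ∂k(xᵀg, ·)` representing the sliced Stein operator. -/
def steinFeature (p : Eucl D → ℝ) (r g x : Eucl D) : H :=
  projScore p r x • feature H (inner ℝ x g)
    + (inner ℝ r g : ℝ) • deriv (feature H) (inner ℝ x g)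

theorem slicedStein_eq_inner (hd : Differentiable ℝ (feature H)) (p : Eucl D → ℝ)
    (r g x : Eucl D) (f : H) : slicedStein p r g f x = inner ℝ (steinFeature H p r g x) f := by
  simp [slicedStein, steinFeature, (hasDerivAt_of_differentiable_feature hd f _).deriv,
    inner_add_left, inner_smul_left, inner_feature]

/-- Differentiating `k(s, t) = ⟨Φ s, Φ t⟩` turns `h` into an expanded square; hypothesis (iv) thus
becomes a second moment bound on the representers. -/
theorem steinKernel_self (hd : Differentiable ℝ (feature H)) (p : Eucl D → ℝ) (r g x : Eucl D) :
    steinKernel (ker H) p r g x x = ‖steinFeature H p r g x‖ ^ 2 := by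
  set u : ℝ := inner ℝ x g
  have h1 : ∀ t, deriv (fun s => ker H s t) u = inner ℝ (deriv (feature H) u) (feature H t) := by
    intro t
    simp only [← feature_apply]
    exact (hasDerivAt_of_differentiable_feature hd _ _).deriv
  have h2 : ∀ s, deriv (fun t => ker H s t) u = inner ℝ (deriv (feature H) u) (feature H s) := by
    intro s
    simp only [ker_comm H s]
    exact h1 s
  have h3 : deriv (fun s => deriv (fun t => ker H s t) u) u
      = inner ℝ (deriv (feature H) u) (deriv (feature H) u) := by
    simp only [h2]
    simpa using (((hasDerivAt_const u (deriv (feature H) u))).inner ℝ (hd u).hasDerivAt).deriv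
  rw [← real_inner_self_eq_norm_sq]
  simp only [steinKernel, steinFeature]
  change projScore p r x * ker H u u * projScore p r x
    + inner ℝ r g * projScore p r x * deriv (fun s => ker H s u) u
    + inner ℝ r g * projScore p r x * deriv (fun t => ker H u t) u
    + (inner ℝ r g) ^ 2 * deriv (fun s => deriv (fun t => ker H s t) u) u = _
  rw [h1, h2, h3, ker_eq_inner]
  simp only [inner_add_left, inner_add_right, inner_smul_left, inner_smul_right,
    RCLike.conj_to_real]
  rw [real_inner_comm (deriv (feature H) u) (feature H u)]
  ring

/-- Since `g` is a unit vector, restricting the sliced kernel to the line `ℝ g` recovers `k`. -/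
theorem contDiff_ker {q : Eucl D → ℝ} {g : Eucl D} (hg : ‖g‖ = 1)
    (hk : KernelInSteinClass q (slicedKernel (ker H) g)) :
    ContDiff ℝ 2 (fun z : ℝ × ℝ => ker H z.1 z.2) := by
  have := hk.contDiff.comp (f := fun z : ℝ × ℝ => (z.1 • g, z.2 • g)) (by fun_prop)
  convert this using 2 with z
  simp [slicedKernel, inner_smul_left, hg]

theorem differentiable_feature {q : Eucl D → ℝ} {g : Eucl D} (hg : ‖g‖ = 1)
    (hk : KernelInSteinClass q (slicedKernel (ker H) g)) : Differentiable ℝ (feature H) :=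
  differentiable_of_contDiff_inner (by simpa only [ker_eq_inner] using contDiff_ker hg hk)

end Feature

/-! ### Ridge functions determine integrable functions -/

section Ridge
variable {D : ℕ}

theorem integral_map_withDensity_ofReal {X : Type*} [MeasurableSpace X] {μ : Measure X} {w : X → ℝ}
    (hw : Measurable w) {φ : X → ℝ} (hφ : Measurable φ) {f : ℝ → ℝ} (hf : Continuous f) :
    ∫ u, f u ∂((μ.withDensity fun x => ENNReal.ofReal (w x)).map φ)
      = ∫ x, max (w x) 0 * f (φ x) ∂μ := by
  rw [integral_map hφ.aemeasurable hf.aestronglyMeasurable,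
    integral_withDensity_eq_integral_toReal_smul (by fun_prop) (by simp)]
  simp [ENNReal.toReal_ofReal']

/-- An integrable function all of whose integrals against ridge functions vanish is zero. -/
theorem ae_eq_zero_of_integral_ridge_eq_zero {w : Eucl D → ℝ} (hwm : Measurable w)
    (hw : Integrable w) [Nonempty (Sph D)]
    (h : ∀ (g : Sph D) (f : ZeroAtInftyContinuousMap ℝ ℝ),
      ∫ x, w x * f (inner ℝ x (g : Eucl D)) = 0) : w =ᵐ[volume] 0 := by
  have fin : ∀ v : Eucl D → ℝ, Integrable v →
      IsFiniteMeasure ((volume : Measure (Eucl D)).withDensity fun x => ENNReal.ofReal (v x)) :=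
    fun v hv => isFiniteMeasure_withDensity_ofReal hv.2
  -- The positive and negative parts of `w` become finite measures, to be shown equal through their
  -- one-dimensional projections.
  set μ := (volume : Measure (Eucl D)).withDensity fun x => ENNReal.ofReal (w x) with hμ
  set ν := (volume : Measure (Eucl D)).withDensity fun x => ENNReal.ofReal (-w x) with hν
  have : IsFiniteMeasure μ := fin w hw
  have : IsFiniteMeasure ν := fin _ hw.neg
  have hmap : ∀ g : Sph D, μ.map (fun x => inner ℝ x (g : Eucl D))
      = ν.map (fun x => inner ℝ x (g : Eucl D)) := by
    intro g
    refine Measure.ext_of_integral_eq_on_compactlySupported fun f => ?_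
    have hm : Measurable fun x : Eucl D => (inner ℝ x (g : Eucl D) : ℝ) := by fun_prop
    obtain ⟨C, hC⟩ := f.hasCompactSupport.exists_bound_of_continuous f.continuous
    have hint : ∀ v : Eucl D → ℝ, Integrable v →
        Integrable fun x => max (v x) 0 * f (inner ℝ x (g : Eucl D)) := fun v hv =>
      hv.pos_part.mul_bdd (c := C)
        (f.continuous.measurable.comp hm).aestronglyMeasurable (.of_forall fun x => hC _)
    rw [hμ, hν, integral_map_withDensity_ofReal hwm hm (f := f) f.continuous,
      integral_map_withDensity_ofReal (w := fun x => -w x) hwm.neg hm (f := f) f.continuous,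
      ← sub_eq_zero, ← integral_sub (hint _ hw) (hint (fun x => -w x) hw.neg)]
    refine Eq.trans ?_ (h g ⟨f.toContinuousMap, f.hasCompactSupport.is_zero_at_infty⟩)
    refine integral_congr_ae (.of_forall fun x => ?_)
    have : max (w x) 0 - max (-w x) 0 = w x := by
      rcases le_total (w x) 0 with hx | hx <;> simp [hx]
    change max (w x) 0 * f _ - max (-w x) 0 * f _ = w x * f _
    rw [← sub_mul, this]
  have hcf : ∀ (ρ : Measure (Eucl D)) (g : Sph D) (c : ℝ),
      charFun ρ (c • (g : Eucl D)) = charFun (ρ.map fun x => inner ℝ x (g : Eucl D)) c := by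
    intro ρ g c
    rw [charFun_apply, charFun_apply_real, integral_map (by fun_prop) (by fun_prop)]
    simp [inner_smul_right]
  have hμν : μ = ν := by
    refine Measure.ext_of_charFun (funext fun ξ => ?_)
    obtain ⟨g, c, rfl⟩ : ∃ (g : Sph D) (c : ℝ), ξ = c • (g : Eucl D) := by
      by_cases hξ : ξ = 0
      · exact ⟨Classical.arbitrary _, 0, by simp [hξ]⟩
      · exact ⟨⟨‖ξ‖⁻¹ • ξ, by simp [norm_smul, hξ]⟩, ‖ξ‖, by simp [smul_smul, hξ]⟩
    rw [hcf, hcf, hmap]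
  -- The two parts are never both nonzero, so their equality forces `w = 0`.
  have hae := (withDensity_eq_iff_of_sigmaFinite (by fun_prop) (by fun_prop)).1 hμν
  filter_upwards [hae] with x hx
  rcases le_total (w x) 0 with h0 | h0
  · rw [ENNReal.ofReal_of_nonpos h0, eq_comm, ENNReal.ofReal_eq_zero] at hx
    exact le_antisymm h0 (neg_nonpos.1 hx)
  · rw [ENNReal.ofReal_of_nonpos (by linarith : -w x ≤ 0), ENNReal.ofReal_eq_zero] at hx
    exact le_antisymm hx h0

end Ridge

/-! ### Scores of positive `C¹` densities -/

section Density
variable {D : ℕ}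

theorem inner_gradient_eq_fderiv (f : Eucl D → ℝ) (x v : Eucl D) :
    inner ℝ (gradient f x) v = fderiv ℝ f x v := by
  rw [← InnerProductSpace.toDual_apply_apply, toDual_gradient]

theorem IsC1Density.contDiff_log {p : Eucl D → ℝ} (hp : IsC1Density p) :
    ContDiff ℝ 1 fun x => Real.log (p x) :=
  hp.contDiff.log fun x => (hp.pos x).ne'

theorem IsC1Density.continuous_score {p : Eucl D → ℝ} (hp : IsC1Density p) :
    Continuous (score p) :=
  (InnerProductSpace.toDual ℝ (Eucl D)).symm.continuous.comp
    (hp.contDiff_log.continuous_fderiv (by norm_num))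

theorem IsC1Density.continuous_projScore {p : Eucl D → ℝ} (hp : IsC1Density p) (r : Eucl D) :
    Continuous (projScore p r) :=
  hp.continuous_score.inner continuous_const

theorem IsC1Density.mul_projScore {q : Eucl D → ℝ} (hq : IsC1Density q) (r x : Eucl D) :
    q x * projScore q r x = fderiv ℝ q x r := by
  have hx := (hq.pos x).ne'
  have := ((hq.contDiff.differentiable (by norm_num)) x).hasFDerivAt.log hx
  rw [projScore, score, inner_gradient_eq_fderiv, this.fderiv]
  simp [hx]

/-- The sliced Stein operator of `q` is the `r`-component of `∇(f(xᵀg) q(x)) / q(x)`. -/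
theorem IsC1Density.mul_slicedStein {q : Eucl D → ℝ} (hq : IsC1Density q) (r g : Eucl D)
    {f : ℝ → ℝ} (hf : Differentiable ℝ f) (x : Eucl D) :
    q x * slicedStein q r g f x
      = inner ℝ r (gradient (fun z => f (inner ℝ z g) * q z) x) := by
  have h1 : HasFDerivAt (fun z : Eucl D => (inner ℝ z g : ℝ)) (innerSL ℝ g) x := by
    simpa only [real_inner_comm g, innerSL_apply_apply] using! (innerSL ℝ g).hasFDerivAt (x := x)
  have h2 := ((hf (inner ℝ x g)).hasDerivAt.comp_hasFDerivAt x h1).mul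
    ((hq.contDiff.differentiable (by norm_num)) x).hasFDerivAt
  rw [real_inner_comm, inner_gradient_eq_fderiv, slicedStein, mul_add, ← mul_assoc,
    hq.mul_projScore]
  erw [h2.fderiv]
  simp [real_inner_comm g r]
  ring

/-- Densities with equal scores are equal. -/
theorem IsC1Density.eq_of_score_eq {p q : Eucl D → ℝ} (hp : IsC1Density p) (hq : IsC1Density q)
    (h : score p = score q) : p = q := by
  have hd : ∀ x, fderiv ℝ (fun z => Real.log (p z) - Real.log (q z)) x = 0 := by
    intro x
    rw [fderiv_fun_sub (hp.contDiff_log.differentiable (by norm_num) x)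
      (hq.contDiff_log.differentiable (by norm_num) x), ← toDual_gradient, ← toDual_gradient,
      ← map_sub]
    have : gradient (fun z => Real.log (p z)) x = gradient (fun z => Real.log (q z)) x :=
      congrFun h x
    rw [this, sub_self, map_zero]
  have hc := is_const_of_fderiv_eq_zero ((hp.contDiff_log.sub hq.contDiff_log).differentiable
    (by norm_num)) hd
  set c := Real.exp (Real.log (p 0) - Real.log (q 0))
  have hpq : ∀ x, p x = c * q x := by
    intro x
    simp only [c]
    rw [← hc x 0, Real.exp_sub, Real.exp_log (hp.pos x), Real.exp_log (hq.pos x),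
      div_mul_cancel₀ _ (hq.pos x).ne']
  -- Equal total mass forces `c = 1`.
  have h1 := hp.integral_eq_one
  simp only [hpq, integral_const_mul, hq.integral_eq_one, mul_one] at h1
  funext x
  rw [hpq, h1, one_mul]

end Density

/-! ### The discrepancy as an integral against the score difference -/

section Functional

variable {H : Type*} [NormedAddCommGroup H] [InnerProductSpace ℝ H] [RKHS ℝ H ℝ ℝ]

theorem discSq_eq_zero_iff {D : ℕ} {q p : Eucl D → ℝ} {r g : Eucl D} :
    discSq H q p r g = 0 ↔ ∀ f : H, ‖f‖ ≤ 1 → expect q (slicedStein p r g f) ≤ 0 := by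
  simp [discSq, EReal.toENNReal_eq_zero_iff]

variable [CompleteSpace H]

/-- A bounded functional given by an integral vanishes if it vanishes on the kernel sections. -/
theorem integral_inner_eq_zero_of_feature {X : Type*} [MeasurableSpace X] {μ : Measure X}
    {ξ : X → H} {b : X → ℝ} (hb : Integrable b μ)
    (hm : ∀ f : H, AEStronglyMeasurable (fun x => (inner ℝ (ξ x) f : ℝ)) μ)
    (hξ : ∀ x, ‖ξ x‖ ≤ b x) (h0 : ∀ t, ∫ x, inner ℝ (ξ x) (feature H t) ∂μ = 0) (f : H) :
    ∫ x, inner ℝ (ξ x) f ∂μ = 0 := by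
  have hbd : ∀ (f : H) x, ‖(inner ℝ (ξ x) f : ℝ)‖ ≤ b x * ‖f‖ := fun f x =>
    (norm_inner_le_norm _ _).trans (by gcongr; exact hξ x)
  have hint : ∀ f : H, Integrable (fun x => (inner ℝ (ξ x) f : ℝ)) μ := fun f =>
    (hb.mul_const ‖f‖).mono' (hm f) (.of_forall (hbd f))
  let ℓ : H →ₗ[ℝ] ℝ :=
    { toFun := fun f => ∫ x, inner ℝ (ξ x) f ∂μ
      map_add' := fun f g => by simp only [inner_add_right]; exact integral_add (hint f) (hint g)
      map_smul' := fun c f => by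
        simp only [inner_smul_right, integral_const_mul, smul_eq_mul, RingHom.id_apply] }
  let L : H →L[ℝ] ℝ := ℓ.mkContinuous (∫ x, b x ∂μ) fun f => by
    rw [← integral_mul_const]
    exact norm_integral_le_of_norm_le (hb.mul_const _) (.of_forall (hbd f))
  -- The value of the Riesz representer at `t` is `L` applied to the section at `t`.
  have hw : (InnerProductSpace.toDual ℝ H).symm L = 0 := by
    refine RKHS.ext fun t => ?_
    rw [← inner_feature, real_inner_comm, InnerProductSpace.toDual_symm_apply, RKHS.coe_zero]
    exact h0 t
  have hL : L = 0 := by simpa using hw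
  exact congrArg (fun T : H →L[ℝ] ℝ => T f) hL

variable {D : ℕ} {p q : Eucl D → ℝ} {r g : Eucl D}

theorem measurable_apply_inner (hd : Differentiable ℝ (feature H)) (g : Eucl D) (f : H) :
    Measurable fun x : Eucl D => f (inner ℝ x g) := by
  have hf : Differentiable ℝ f :=
    fun s => (hasDerivAt_of_differentiable_feature hd f s).differentiableAt
  exact hf.continuous.measurable.comp (by fun_prop)

theorem measurable_slicedStein (hp : IsC1Density p) (hd : Differentiable ℝ (feature H))
    (r g : Eucl D) (f : H) : Measurable (slicedStein p r g f) := by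
  have h1 : Measurable fun x : Eucl D => (inner ℝ x g : ℝ) := by fun_prop
  exact ((hp.continuous_projScore r).measurable.mul (measurable_apply_inner hd g f)).add
    (((measurable_deriv f).comp h1).const_mul _)

/-- From `‖v‖ ≤ 1 + ‖v‖²`: a finite second moment yields an integrable bound. -/
theorem norm_steinFeature_le (hq : ∀ x, 0 < q x) (hd : Differentiable ℝ (feature H))
    (p : Eucl D → ℝ) (r g x : Eucl D) :
    ‖q x • steinFeature H p r g x‖ ≤ q x + q x * steinKernel (ker H) p r g x x := by
  rw [steinKernel_self hd, norm_smul, Real.norm_of_nonneg (hq x).le, ← mul_one_add]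
  gcongr
  · exact (hq x).le
  · nlinarith [sq_nonneg (‖steinFeature H p r g x‖ - 1)]

theorem integrable_mul_slicedStein (hp : IsC1Density p) (hq : IsC1Density q)
    (hd : Differentiable ℝ (feature H))
    (hh : Integrable fun x => q x * steinKernel (ker H) p r g x x) (f : H) :
    Integrable fun x => q x * slicedStein p r g f x := by
  refine ((hq.integrable.add hh).mul_const ‖f‖).mono'
    (hq.contDiff.continuous.measurable.mul
      (measurable_slicedStein hp hd r g f)).aestronglyMeasurable (.of_forall fun x => ?_)
  rw [slicedStein_eq_inner hd, ← real_inner_smul_left]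
  refine (norm_inner_le_norm _ _).trans ?_
  gcongr
  exact norm_steinFeature_le hq.pos hd p r g x

theorem norm_feature_le {g : Eucl D} {B : ℝ}
    (hB : ∀ x, slicedKernel (ker H) g x x ≤ B) (x : Eucl D) :
    ‖feature H (inner ℝ x g)‖ ≤ √B := by
  refine Real.le_sqrt_of_sq_le ?_
  rw [norm_feature_sq]
  exact hB x

/-- The Stein discrepancy functional is the integral against the difference of the scores. -/
theorem expect_slicedStein (hp : IsC1Density p) (hq : IsC1Density q) (hg : ‖g‖ = 1)
    (hk : KernelInSteinClass q (slicedKernel (ker H) g))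
    (hbdd : BddAbove (Set.range fun x : Eucl D => slicedKernel (ker H) g x x))
    (hw : Integrable fun x => q x * inner ℝ (score p x - score q x) r)
    (hh : Integrable fun x => q x * steinKernel (ker H) p r g x x) (f : H) :
    expect q (slicedStein p r g f)
      = ∫ x, (q x * inner ℝ (score p x - score q x) r) * f (inner ℝ x g) := by
  obtain ⟨B, hB⟩ := hbdd
  replace hB : ∀ x, slicedKernel (ker H) g x x ≤ B := fun x => hB ⟨x, rfl⟩
  have hd := differentiable_feature hg hk
  set w : Eucl D → ℝ := fun x => q x * inner ℝ (score p x - score q x) r with hw_def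
  have hwm : Continuous w := hq.contDiff.continuous.mul
    ((hp.continuous_score.sub hq.continuous_score).inner continuous_const)
  -- This represents the Stein operator of `q`, but is written through that of `p`: (iv) controls
  -- only `p`, and the correction is controlled by integrability of `w` and boundedness of the
  -- kernel.
  let ξ : Eucl D → H := fun x =>
    q x • steinFeature H p r g x - w x • feature H (inner ℝ x g)
  have hξ_inner : ∀ (f : H) x,
      inner ℝ (ξ x) f = q x * slicedStein p r g f x - w x * f (inner ℝ x g) := by
    intro f x
    simp only [ξ, inner_sub_left, real_inner_smul_left, inner_feature, slicedStein_eq_inner hd]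
  have hξ_stein : ∀ (f : H) x, inner ℝ (ξ x) f = q x * slicedStein q r g f x := by
    intro f x
    rw [hξ_inner]
    simp only [hw_def, slicedStein, projScore, inner_sub_left]
    ring
  have hwf : Integrable fun x => w x * f (inner ℝ x g) := by
    refine hw.mul_bdd (c := √B * ‖f‖) (measurable_apply_inner hd g f).aestronglyMeasurable
      (.of_forall fun x => ?_)
    rw [← inner_feature]
    refine (norm_inner_le_norm _ _).trans ?_
    gcongr
    exact norm_feature_le hB x
  have hzero : ∫ x, inner ℝ (ξ x) f = 0 := by
    refine integral_inner_eq_zero_of_feature (b := fun x =>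
      (q x + q x * steinKernel (ker H) p r g x x) + ‖w x‖ * √B)
      ((hq.integrable.add hh).add (hw.norm.mul_const _)) (fun f => ?_) (fun x => ?_)
      (fun t => ?_) f
    · simp only [hξ_stein]
      exact (hq.contDiff.continuous.measurable.mul
        (measurable_slicedStein hq hd r g f)).aestronglyMeasurable
    · refine (norm_sub_le _ _).trans (add_le_add (norm_steinFeature_le hq.pos hd p r g x) ?_)
      rw [norm_smul]
      gcongr
      exact norm_feature_le hB x
    -- As `(t • g)ᵀ g = t`, the section at `t • g` is the ridge function of `k(t, ·)`; the
    -- `r`-component of its Stein identity is the claim.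
    · have hs := hk.left (t • g)
      have heq : ∀ y, slicedKernel (ker H) g (t • g) y = feature H t (inner ℝ y g) := by
        intro y
        rw [feature_apply, ker_comm]
        simp [slicedKernel, real_inner_smul_left, hg]
      simp only [hξ_stein]
      simp only [hq.mul_slicedStein r g
        fun s => (hasDerivAt_of_differentiable_feature hd (feature H t) s).differentiableAt]
      simp only [← heq]
      rw [integral_inner hs.integrable, hs.integral_eq_zero, inner_zero_right]
  simp only [hξ_inner] at hzero
  rw [integral_sub (integrable_mul_slicedStein hp hq hd hh f) hwf, sub_eq_zero] at hzero
  exact hzero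

end Functional

/-! ### From the RKHS to `C₀(ℝ)` -/

section Separation

variable {D : ℕ} {H : Type*} [NormedAddCommGroup H] [InnerProductSpace ℝ H] [RKHS ℝ H ℝ ℝ]

/-- If `f` in `H` is uniformly `ε`-close to `φ`, replacing `φ` by `f` changes the integral by at
most `ε ‖w‖₁`. -/
theorem integral_mul_zeroAtInfty_eq_zero (hH : IsC0Universal H) {w : Eucl D → ℝ}
    (hw : Integrable w) {g : Eucl D} (h : ∀ f : H, ∫ x, w x * f (inner ℝ x g) = 0)
    (φ : ZeroAtInftyContinuousMap ℝ ℝ) : ∫ x, w x * φ (inner ℝ x g) = 0 := by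
  set C := ∫ x, ‖w x‖
  have hC : 0 ≤ C := integral_nonneg fun x => norm_nonneg _
  have key : ∀ ε > 0, ‖∫ x, w x * φ (inner ℝ x g)‖ ≤ C * ε := by
    intro ε hε
    obtain ⟨f, hf⟩ := hH.dense φ ε hε
    have hc : Continuous fun x : Eucl D => (inner ℝ x g : ℝ) := by fun_prop
    have hφ : Integrable fun x => w x * φ (inner ℝ x g) :=
      hw.mul_bdd (c := ‖φ.toBCF‖) (φ.continuous.comp hc).aestronglyMeasurable
        (.of_forall fun x => φ.toBCF.norm_coe_le_norm _)
    have hdiff : Integrable fun x => w x * (f (inner ℝ x g) - φ (inner ℝ x g)) :=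
      hw.mul_bdd (c := ε)
        (((hH.continuous f).comp hc).sub (φ.continuous.comp hc)).aestronglyMeasurable
        (.of_forall fun x => hf _)
    have hsum : ∫ x, w x * (f (inner ℝ x g) - φ (inner ℝ x g))
        = -∫ x, w x * φ (inner ℝ x g) := by
      have h1 := integral_add hdiff hφ
      simp only [← mul_add, sub_add_cancel, h f] at h1
      linarith
    rw [← norm_neg, ← hsum, ← integral_mul_const]
    refine norm_integral_le_of_norm_le (hw.norm.mul_const ε) (.of_forall fun x => ?_)
    rw [norm_mul]
    gcongr
    exact hf _
  rw [← norm_le_zero_iff]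
  refine le_of_forall_pos_le_add fun ε hε => ?_
  refine (key (ε / (C + 1)) (by positivity)).trans ?_
  rw [zero_add, mul_div_assoc', div_le_iff₀ (by positivity)]
  nlinarith

end Separation
end SKSD
end
-- Vanishing of the maximal discrepancy
theorem corollary2 {D : ℕ}
    (p q : SKSD.Eucl D → ℝ)
    (hp : SKSD.IsC1Density p) (hq : SKSD.IsC1Density q)
    (hq_lim : Filter.Tendsto q (Filter.cocompact (SKSD.Eucl D)) (nhds 0))
    (hscore_L1 : ∀ r : SKSD.Sph D, MeasureTheory.Integrable
      (fun x => q x * |inner ℝ (SKSD.score p x - SKSD.score q x) (r : SKSD.Eucl D)|)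
      MeasureTheory.volume)
    (hscore_L2 : ∀ r : SKSD.Sph D, MeasureTheory.Integrable
      (fun x => q x * |inner ℝ (SKSD.score p x - SKSD.score q x) (r : SKSD.Eucl D)| ^ 2)
      MeasureTheory.volume)
    (O : OrthonormalBasis (Fin D) ℝ (SKSD.Eucl D))
    (H : Fin D → SKSD.Sph D → Type*)
    [∀ i g, NormedAddCommGroup (H i g)] [∀ i g, InnerProductSpace ℝ (H i g)]
    [∀ i g, CompleteSpace (H i g)] [∀ i g, RKHS ℝ (H i g) ℝ ℝ]
    (hker_univ : ∀ i g, SKSD.IsC0Universal (H i g))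
    (hker_stein : ∀ i g, SKSD.KernelInSteinClass q
      (SKSD.slicedKernel (SKSD.ker (H i g)) (g : SKSD.Eucl D)))
    (hker_bdd : ∀ i g, BddAbove (Set.range fun x : SKSD.Eucl D =>
      SKSD.slicedKernel (SKSD.ker (H i g)) (g : SKSD.Eucl D) x x))
    (hh : ∀ i g, MeasureTheory.Integrable
      (fun x => q x * SKSD.steinKernel (SKSD.ker (H i g)) p (O i) (g : SKSD.Eucl D) x x)
      MeasureTheory.volume) :
    SKSD.maxSKSD O H q p = 0 ↔ p =ᵐ[MeasureTheory.volume] q := by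
  have hcont : ∀ i, Continuous fun x => q x * inner ℝ (SKSD.score p x - SKSD.score q x) (O i) :=
    fun i => hq.contDiff.continuous.mul
      ((hp.continuous_score.sub hq.continuous_score).inner continuous_const)
  have hw : ∀ i, MeasureTheory.Integrable
      (fun x => q x * inner ℝ (SKSD.score p x - SKSD.score q x) (O i)) := by
    intro i
    refine (hscore_L1 ⟨O i, by simp⟩).mono' (hcont i).aestronglyMeasurable (.of_forall fun x => ?_)
    rw [norm_mul, Real.norm_of_nonneg (hq.pos x).le, Real.norm_eq_abs]
  have hexp : ∀ i (g : SKSD.Sph D) (f : H i g),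
      SKSD.expect q (SKSD.slicedStein p (O i) g f) = ∫ x,
        (q x * inner ℝ (SKSD.score p x - SKSD.score q x) (O i)) * f (inner ℝ x (g : SKSD.Eucl D)) :=
    fun i g => SKSD.expect_slicedStein hp hq (by simp) (hker_stein i g) (hker_bdd i g) (hw i)
      (hh i g)
  have hiff : SKSD.maxSKSD O H q p = 0 ↔ ∀ i (g : SKSD.Sph D) (f : H i g), ‖f‖ ≤ 1 →
      SKSD.expect q (SKSD.slicedStein p (O i) g f) ≤ 0 := by
    simp [SKSD.maxSKSD, SKSD.discSq_eq_zero_iff]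
  rw [hiff]
  constructor
  · intro h
    have hzero : ∀ i (g : SKSD.Sph D) (f : H i g), ∫ x,
        (q x * inner ℝ (SKSD.score p x - SKSD.score q x) (O i)) * f (inner ℝ x (g : SKSD.Eucl D))
          = 0 := by
      intro i g
      have hle : ∀ f : H i g, ∫ x, (q x * inner ℝ (SKSD.score p x - SKSD.score q x) (O i)) *
          f (inner ℝ x (g : SKSD.Eucl D)) ≤ 0 := by
        intro f
        have hc : 0 < ‖f‖ + 1 := by positivity
        -- Scaling by `(‖f‖ + 1)⁻¹` reaches the unit ball even when `f = 0`; applying the bound to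
        -- `-f` then gives equality.
        have := h i g ((‖f‖ + 1)⁻¹ • f) (by
          rw [norm_smul, Real.norm_of_nonneg (by positivity), inv_mul_le_iff₀ hc]
          linarith)
        rw [hexp] at this
        simp only [RKHS.coe_smul, Pi.smul_apply, smul_eq_mul, mul_left_comm _ (‖f‖ + 1)⁻¹,
          MeasureTheory.integral_const_mul] at this
        exact nonpos_of_mul_nonpos_right this (inv_pos.2 hc)
      intro f
      refine le_antisymm (hle f) ?_
      have := hle (-f)
      simp only [RKHS.coe_neg, Pi.neg_apply, mul_neg, MeasureTheory.integral_neg] at this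
      linarith
    have hw0 : ∀ i x, q x * inner ℝ (SKSD.score p x - SKSD.score q x) (O i) = 0 := by
      intro i
      -- An index `i` rules out `D = 0`, where the sphere is empty.
      have : Nonempty (SKSD.Sph D) := ⟨⟨O i, by simp⟩⟩
      exact congrFun ((hcont i).ae_eq_iff_eq MeasureTheory.volume continuous_zero |>.1
        (SKSD.ae_eq_zero_of_integral_ridge_eq_zero (hcont i).measurable (hw i) fun g φ =>
          SKSD.integral_mul_zeroAtInfty_eq_zero (hker_univ i g) (hw i) (hzero i g) φ))
    rw [hp.eq_of_score_eq hq (funext fun x => sub_eq_zero.1 (O.repr.map_eq_zero_iff.1 (by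
      ext i
      rw [O.repr_apply_apply, real_inner_comm]
      simpa [(hq.pos x).ne'] using hw0 i x)))]
  · intro h
    have hpq : p = q := (hp.contDiff.continuous.ae_eq_iff_eq MeasureTheory.volume
      hq.contDiff.continuous).1 h
    intro i g f _
    rw [hexp]
    simp [hpq]
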